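/- Let $(*)$ denote the following dichotomy for p-ideals of countable sets. An ideal $\mathcal I$ of subsets of a set $S$ is a \emph{p-ideal} if for every sequence $\langle A_n:n\in\omega\rangle$ of members of $\mathcal I$ there is $A\in\mathcal I$ such that $A_n\setminus A$ is finite for every $n$. Then $(*)$ says: for every infinite set $S$ and every p-ideal $\mathcal I$ on $S$ all of whose members are countable, either (i) there is an uncountable $Y\subseteq S$ such that every countable subset of $Y$ belongs to $\mathcal I$, or (ii) there are sets $S_n$ $(n\in\omega)$ with $\bigcup_n S_n=S$ such that $S_n\cap I$ is finite for all $n\in\omega$ and $I\in\mathcal I$. In a Boolean algebra, an \emph{antichain} is a set of nonzero pairwise disjoint elements. A complete Boolean algebra $B$ is \emph{ccc} if every antichain in $B$ is countable, and \emph{weakly distributive} if for every sequence $\langle P_n:n\in\omega\rangle$ of countable maximal antichains there is a maximal antichain $Q$ such that each $q\in Q$ meets (has nonzero meet with) only finitely many elements of each $P_n$. A \emph{strictly positive Maharam submeasure} on $B$ is a function $\mu:B\to[0,\infty)$ such that $\mu(a)=0$ if and only if $a=\mathbf 0$; $\mu(a)\le\mu(b)$ whenever $a\le b$; $\mu(a\vee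 b)\le\mu(a)+\mu(b)$; and $\lim_n\mu(a_n)=0$ for every decreasing sequence $\langle a_n:n\in\omega\rangle$ with $\bigwedge_n a_n=\mathbf 0$. \textbf{Theorem.} Assume $(*)$. Then every weakly distributive ccc complete Boolean algebra carries a strictly positive Maharam submeasure. -/

import Mathlib

open Set Filter Topology

universe u

namespace BooleanSubmeasure

/-- An ideal of sets is a p-ideal if every sequence of its members is almost included in a single
member. -/
def IsPIdeal {S : Type u} (I : Order.Ideal (Set S)) : Prop :=
  ∀ A : ℕ → Set S, (∀ n, A n ∈ I) → ∃ C ∈ I, ∀ n, (A n \ C).Finite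

/-- The dichotomy (*) for p-ideals of countable sets: for every p-ideal `I` of countable subsets of
an infinite set `S`, either all countable subsets of some uncountable `Y` belong to `I`, or `S` is
the union of countably many sets each of which has finite intersection with every member of `I`. -/
def PIdealDichotomy : Prop :=
  ∀ (S : Type u) [Infinite S] (I : Order.Ideal (Set S)),
    (∀ A ∈ I, A.Countable) → IsPIdeal I →
      (∃ Y : Set S, ¬ Y.Countable ∧ ∀ A : Set S, A ⊆ Y → A.Countable → A ∈ I) ∨
      (∃ T : ℕ → Set S, (⋃ n, T n) = univ ∧ ∀ n, ∀ A ∈ I, (T n ∩ A).Finite)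

section Algebra

variable {B : Type u} [CompleteBooleanAlgebra B]

/-- An antichain in the sense of Boolean algebras: a set of nonzero pairwise disjoint elements. -/
def IsDisjointFamily (P : Set B) : Prop :=
  ⊥ ∉ P ∧ P.PairwiseDisjoint id

/-- A maximal antichain (maximal with respect to inclusion). -/
def IsMaximalDisjointFamily (P : Set B) : Prop :=
  Maximal IsDisjointFamily P

variable (B) in
/-- The countable chain condition: every antichain is countable. -/
def CCC : Prop :=
  ∀ P : Set B, IsDisjointFamily P → P.Countable

variable (B) in
/-- Weak distributivity: for every sequence of countable maximal antichains there is a maximal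
antichain `Q` each of whose elements meets only finitely many elements of each of them. -/
def WeaklyDistributive : Prop :=
  ∀ P : ℕ → Set B, (∀ n, (P n).Countable ∧ IsMaximalDisjointFamily (P n)) →
    ∃ Q : Set B, IsMaximalDisjointFamily Q ∧
      ∀ q ∈ Q, ∀ n, {p | p ∈ P n ∧ q ⊓ p ≠ ⊥}.Finite

/-- A submeasure: a nonnegative real-valued, monotone, subadditive function vanishing at `⊥`. -/
structure IsSubmeasure (μ : B → ℝ) : Prop where
  nonneg : ∀ a, 0 ≤ μ a
  bot : μ ⊥ = 0
  mono : ∀ a b, a ≤ b → μ a ≤ μ b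
  sup_le : ∀ a b, μ (a ⊔ b) ≤ μ a + μ b

/-- A Maharam submeasure: a submeasure which is continuous along decreasing sequences with
infimum `⊥`. -/
structure IsMaharamSubmeasure (μ : B → ℝ) : Prop extends IsSubmeasure μ where
  continuous : ∀ a : ℕ → B, Antitone a → (⨅ n, a n) = ⊥ →
    Tendsto (fun n => μ (a n)) atTop (𝓝 0)

/-- Strict positivity: only `⊥` has value `0`. -/
def IsStrictlyPositive (μ : B → ℝ) : Prop :=
  ∀ a, μ a = 0 → a = ⊥

end Algebra

end BooleanSubmeasure

/-!
Call a sequence in `B` null if it tends to `⊥` in order, and a lower set a neighbourhood of `⊥` if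
it contains the tail of every null sequence. The countable sets whose enumerations are null form a
p-ideal, by weak distributivity. Applied to it, the dichotomy gives countably many neighbourhoods
with intersection `{⊥}`: its first alternative would require uncountably many nonzero elements all
of whose sequences are null, and the ccc forbids this.

Weak distributivity lets null sequences be diagonalized. Hence every `a ≠ ⊥` avoids all `u ⊔ v` with
`u`, `v` in some neighbourhood, and every neighbourhood contains one that is open, in the sense that
its translates by its members are again neighbourhoods. From the latter and the ccc it follows that
for every neighbourhood `U` and every `N` there is a neighbourhood `V` such that joins of `N`
members of `V` lie below joins of two members of `U`: choose counterexamples along a shrinking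
sequence of open neighbourhoods and thin them out so that every further subsequence has the same
tail joins. The join of a single sequence running through the coordinates then covers the join of
one of the counterexamples up to a small remainder.

So `a ≠ ⊥` is left out by a chain of neighbourhoods, each containing the triple joins of the next,
and by the ccc a single chain leaves out every `a ≠ ⊥`. The Birkhoff–Kakutani construction applied
to symmetric differences turns it into a pseudometric, and `μ a = dist ⊥ a` is the submeasure.
-/

namespace BooleanSubmeasure

open scoped NNReal

section Preliminaries

theorem cofinite_inf_principal_range_le_map {ι S : Type*} (y : ι → S) :
    cofinite ⊓ 𝓟 (range y) ≤ map y cofinite := by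
  intro s hs
  rw [mem_inf_principal, mem_cofinite]
  refine (Finite.image y (mem_cofinite.1 (mem_map.1 hs))).subset fun p hp => ?_
  obtain ⟨⟨i, rfl⟩, hi⟩ := Classical.not_imp.1 hp
  exact mem_image_of_mem y hi

theorem eventually_cofinite_inf_principal {S : Type*} {A : Set S} {P : S → Prop} :
    (∀ᶠ p in cofinite ⊓ 𝓟 A, P p) ↔ {p ∈ A | ¬ P p}.Finite := by
  simp only [eventually_inf_principal, eventually_cofinite, Classical.not_imp]

theorem exists_seq_forall_frequently_eq (ι : Type*) [Countable ι] [Nonempty ι] :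
    ∃ σ : ℕ → ι, ∀ i, ∃ᶠ n in atTop, σ n = i := by
  obtain ⟨e, he⟩ := exists_surjective_nat ι
  refine ⟨fun n => e n.unpair.1, fun i => frequently_atTop.2 fun k => ?_⟩
  obtain ⟨j, rfl⟩ := he i
  exact ⟨Nat.pair j k, Nat.right_le_pair j k, by simp only [Nat.unpair_pair]⟩

theorem partialSups_mem_of_sup_mem {α : Type*} [SemilatticeSup α] {V : ℕ → Set α} {x : ℕ → α}
    (hx : ∀ n, x n ∈ V n) (hsup : ∀ n, ∀ w ∈ V (n + 1), x n ⊔ w ∈ V n) (n : ℕ) :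
    partialSups x n ∈ V 0 := by
  induction n generalizing V x with
  | zero => simpa only [partialSups_zero] using hx 0
  | succ n ih =>
    rw [partialSups_add_one']
    exact hsup 0 _ (ih (V := fun n => V (n + 1)) (fun n => hx (n + 1)) fun n => hsup (n + 1))

theorem exists_le_of_finite_inf_ne_bot {α : Type*} [CompleteBooleanAlgebra α] {q : ℕ → α}
    (hq : Monotone q) {a : α} (ha : a ≤ ⨆ k, q k)
    (hfin : {p ∈ range (disjointed q) | a ⊓ p ≠ ⊥}.Finite) : ∃ k, a ≤ q k := by
  have hle : ∀ p ∈ {p ∈ range (disjointed q) | a ⊓ p ≠ ⊥}, ∀ᶠ k in atTop, p ≤ q k := by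
    rintro _ ⟨⟨j, rfl⟩, -⟩
    exact (eventually_ge_atTop j).mono fun k hjk => (disjointed_le q j).trans (hq hjk)
  obtain ⟨k, hk⟩ := (hfin.eventually_all.2 hle).exists
  refine ⟨k, ?_⟩
  calc a = ⨆ j, a ⊓ disjointed q j := by rw [← inf_iSup_eq, iSup_disjointed, inf_eq_left.2 ha]
    _ ≤ q k := iSup_le fun j => ?_
  by_cases hj : a ⊓ disjointed q j = ⊥
  · exact hj ▸ bot_le
  · exact inf_le_right.trans (hk _ ⟨mem_range_self j, hj⟩)

end Preliminaries

section Exhaustion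

variable {α : Type*} [Order.Frame α]

/-- An exhaustion: an increasing sequence with supremum `⊤`. It encodes the countable maximal
antichain of its successive differences. -/
structure IsExhaustion (q : ℕ → α) : Prop where
  monotone : Monotone q
  iSup_eq_top : ⨆ k, q k = ⊤

theorem isExhaustion_top : IsExhaustion (fun _ => ⊤ : ℕ → α) :=
  ⟨monotone_const, iSup_const⟩

theorem IsExhaustion.inf {p q : ℕ → α} (hp : IsExhaustion p) (hq : IsExhaustion q) :
    IsExhaustion fun k => p k ⊓ q k :=
  ⟨hp.monotone.inf hq.monotone, by
    rw [iSup_inf_of_monotone hp.monotone hq.monotone, hp.iSup_eq_top, hq.iSup_eq_top, inf_top_eq]⟩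

theorem IsExhaustion.eq_bot_of_forall_disjoint {q : ℕ → α} (hq : IsExhaustion q) {a : α}
    (h : ∀ k, Disjoint (q k) a) : a = ⊥ := by
  rw [← top_disjoint, ← hq.iSup_eq_top]
  exact iSup_disjoint_iff.2 h

end Exhaustion

section Null

variable {α : Type*} [Order.Frame α] {ι κ : Type*} {l l' : Filter ι} {x y : ι → α}

/-- A family is null along a filter if it tends to `⊥` in the order-theoretic sense: each term of
some exhaustion is eventually disjoint from it. -/
def IsNull (l : Filter ι) (x : ι → α) : Prop :=
  ∃ q : ℕ → α, IsExhaustion q ∧ ∀ k, ∀ᶠ i in l, Disjoint (q k) (x i)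

theorem isNull_bot (l : Filter ι) : IsNull l (fun _ => ⊥ : ι → α) :=
  ⟨_, isExhaustion_top, fun _ => .of_forall fun _ => disjoint_bot_right⟩

theorem IsNull.mono (hx : IsNull l x) (h : ∀ i, y i ≤ x i) : IsNull l y := by
  obtain ⟨q, hq, hqx⟩ := hx
  exact ⟨q, hq, fun k => (hqx k).mono fun i hi => hi.mono_right (h i)⟩

theorem IsNull.comp_tendsto (hx : IsNull l x) {m : Filter κ} {φ : κ → ι} (hφ : Tendsto φ m l) :
    IsNull m (x ∘ φ) := by
  obtain ⟨q, hq, hqx⟩ := hx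
  exact ⟨q, hq, fun k => hφ.eventually (hqx k)⟩

theorem IsNull.mono_filter (hx : IsNull l x) (h : l' ≤ l) : IsNull l' x :=
  hx.comp_tendsto (φ := id) h

theorem IsNull.sup (hx : IsNull l x) (hy : IsNull l y) : IsNull l fun i => x i ⊔ y i := by
  obtain ⟨p, hp, hpx⟩ := hx
  obtain ⟨q, hq, hqy⟩ := hy
  refine ⟨_, hp.inf hq, fun k => ?_⟩
  filter_upwards [hpx k, hqy k] with i hxi hyi
  exact disjoint_sup_right.2 ⟨hxi.mono_left inf_le_left, hyi.mono_left inf_le_right⟩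

theorem IsNull.sup_filter (hl : IsNull l x) (hl' : IsNull l' x) : IsNull (l ⊔ l') x := by
  obtain ⟨p, hp, hpx⟩ := hl
  obtain ⟨q, hq, hqx⟩ := hl'
  exact ⟨_, hp.inf hq, fun k => eventually_sup.2
    ⟨(hpx k).mono fun _ h => h.mono_left inf_le_left,
      (hqx k).mono fun _ h => h.mono_left inf_le_right⟩⟩

theorem IsNull.iSup [Finite κ] {x : κ → ι → α} (hx : ∀ k, IsNull l (x k)) :
    IsNull l fun i => ⨆ k, x k i := by
  classical
  cases nonempty_fintype κ
  suffices ∀ s : Finset κ, IsNull l fun i => s.sup fun k => x k i by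
    simpa only [Finset.sup_univ_eq_iSup] using this Finset.univ
  intro s
  induction s using Finset.induction_on with
  | empty => exact isNull_bot l
  | insert k s _ ih => simpa only [Finset.sup_insert] using (hx k).sup ih

theorem IsNull.eventually_eq_bot (hx : IsNull l x) (hfin : (range x).Finite) :
    ∀ᶠ i in l, x i = ⊥ := by
  obtain ⟨q, hq, hqx⟩ := hx
  have hne : ∀ a ∈ range x, ∀ᶠ i in l, a ≠ ⊥ → x i ≠ a := by
    intro a _
    by_cases ha : a = ⊥
    · exact .of_forall fun _ h => absurd ha h
    obtain ⟨k, hk⟩ : ∃ k, ¬ Disjoint (q k) a := by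
      by_contra! h
      exact ha (hq.eq_bot_of_forall_disjoint h)
    filter_upwards [hqx k] with i hi _ hia
    exact hk (hia ▸ hi)
  filter_upwards [hfin.eventually_all.2 hne] with i hi
  by_contra h
  exact hi _ (mem_range_self i) h rfl

end Null

section NullBoolean

variable {α : Type*} [CompleteBooleanAlgebra α] {ι : Type*}

theorem isNull_of_antitone {a : ℕ → α} (ha : Antitone a) (hinf : ⨅ n, a n = ⊥) :
    IsNull atTop a :=
  ⟨fun k => (a k)ᶜ, ⟨fun _ _ h => compl_le_compl (ha h), by rw [← compl_iInf, hinf, compl_bot]⟩,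
    fun k => (eventually_ge_atTop k).mono fun _ hn => disjoint_compl_left.mono_right (ha hn)⟩

theorem isNull_iSup_sdiff_partialSups (x : ℕ → α) :
    IsNull atTop fun n => (⨆ k, x k) \ partialSups x n := by
  refine isNull_of_antitone (fun m n h => sdiff_le_sdiff_left ((partialSups x).monotone h)) ?_
  simp only [_root_.sdiff_eq]
  rw [← inf_iInf, ← compl_iSup, iSup_partialSups_eq, inf_compl_eq_bot]

theorem isNull_sdiff_limsup (l : Filter ι) [l.IsCountablyGenerated] (x : ι → α) :
    IsNull l fun i => x i \ limsup x l := by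
  obtain ⟨s, hs⟩ := l.exists_antitone_basis
  refine ⟨fun k => limsup x l ⊔ (⨆ i ∈ s k, x i)ᶜ, ⟨fun j k h => ?_, ?_⟩, fun k => ?_⟩
  · exact sup_le_sup_left (compl_le_compl (biSup_mono (hs.antitone h))) _
  · have hlim : limsup x l = ⨅ k, ⨆ i ∈ s k, x i := by
      simpa only [iInf_pos] using hs.1.limsup_eq_iInf_iSup
    rw [← sup_iSup, ← compl_iInf, ← hlim, sup_compl_eq_top]
  · filter_upwards [hs.mem k] with i hi
    exact disjoint_sup_left.2 ⟨disjoint_sdiff_self_right,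
      disjoint_compl_left.mono_right (sdiff_le.trans (le_biSup x hi))⟩

end NullBoolean

section CountableChainCondition

variable {B : Type u} [CompleteBooleanAlgebra B]

theorem IsDisjointFamily.insert {P : Set B} (hP : IsDisjointFamily P) {a : B} (ha : a ≠ ⊥)
    (haP : Disjoint a (sSup P)) : IsDisjointFamily (insert a P) := by
  refine ⟨?_, hP.2.insert fun p hp _ => haP.mono_right (le_sSup hp)⟩
  rw [mem_insert_iff, not_or]
  exact ⟨ha.symm, hP.1⟩

theorem notMem_of_disjoint_sSup {P : Set B} {a : B} (ha : a ≠ ⊥) (haP : Disjoint a (sSup P)) :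
    a ∉ P :=
  fun h => ha (disjoint_self.1 (haP.mono_right (le_sSup h)))

theorem IsMaximalDisjointFamily.sSup_eq_top {P : Set B} (hP : IsMaximalDisjointFamily P) :
    sSup P = ⊤ := by
  by_contra hne
  have hbot : (sSup P)ᶜ ≠ ⊥ := fun h => hne (compl_eq_bot.1 h)
  exact notMem_of_disjoint_sSup hbot disjoint_compl_left <|
    hP.le_of_ge (hP.prop.insert hbot disjoint_compl_left) (subset_insert _ _) (mem_insert _ _)

theorem IsDisjointFamily.isMaximalDisjointFamily {P : Set B} (hP : IsDisjointFamily P)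
    (htop : sSup P = ⊤) : IsMaximalDisjointFamily P := by
  refine ⟨hP, fun P' hP' hle p hp => ?_⟩
  by_contra hpP
  have hdisj : Disjoint p (sSup P) := disjoint_sSup_iff.2 fun a ha =>
    hP'.2 hp (hle ha) fun h => hpP (h ▸ ha)
  rw [htop, disjoint_top] at hdisj
  exact hP'.1 (hdisj ▸ hp)

theorem IsExhaustion.isMaximalDisjointFamily_disjointed {q : ℕ → B} (hq : IsExhaustion q) :
    IsMaximalDisjointFamily (range (disjointed q) \ {⊥}) := by
  refine IsDisjointFamily.isMaximalDisjointFamily ⟨fun h => h.2 rfl, ?_⟩ ?_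
  · rintro _ ⟨⟨i, rfl⟩, -⟩ _ ⟨⟨j, rfl⟩, -⟩ hij
    exact disjoint_disjointed q fun h => hij (h ▸ rfl)
  · rw [sSup_sdiff_singleton_bot, sSup_range, iSup_disjointed, hq.iSup_eq_top]

theorem exists_isDisjointFamily_sSup_eq {D : Set B} (hD : IsLowerSet D) :
    ∃ P ⊆ D, IsDisjointFamily P ∧ sSup P = sSup D := by
  obtain ⟨P, hP⟩ := zorn_subset {P : Set B | P ⊆ D ∧ IsDisjointFamily P} fun c hc hchain =>
    ⟨⋃₀ c, ⟨sUnion_subset fun P hP => (hc hP).1, fun ⟨P, hP, hbot⟩ => (hc hP).2.1 hbot,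
      (pairwiseDisjoint_sUnion hchain.directedOn).2 fun P hP => (hc hP).2.2⟩,
      fun P hP => subset_sUnion_of_mem hP⟩
  refine ⟨P, hP.prop.1, hP.prop.2, le_antisymm (sSup_le_sSup hP.prop.1) (sSup_le fun d hd => ?_)⟩
  by_contra hle
  have hbot : d \ sSup P ≠ ⊥ := fun h => hle (sdiff_eq_bot_iff.1 h)
  have hins : insert (d \ sSup P) P ⊆ D := insert_subset (hD sdiff_le hd) hP.prop.1
  exact notMem_of_disjoint_sSup hbot disjoint_sdiff_self_left <|
    hP.le_of_ge ⟨hins, hP.prop.2.insert hbot disjoint_sdiff_self_left⟩ (subset_insert _ _)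
      (mem_insert _ _)

theorem CCC.exists_countable_biSup_eq (hB : CCC B) {ι : Type*} (f : ι → B) (s : Set ι) :
    ∃ t ⊆ s, t.Countable ∧ ⨆ i ∈ t, f i = ⨆ i ∈ s, f i := by
  obtain ⟨P, hPD, hP, hsup⟩ := exists_isDisjointFamily_sSup_eq (lowerClosure (f '' s)).lower
  have hle : ∀ p ∈ P, ∃ i ∈ s, p ≤ f i := fun p hp => by
    simpa only [SetLike.mem_coe, mem_lowerClosure, exists_mem_image] using hPD hp
  have := (hB P hP).to_subtype
  choose g hgs hg using fun p : P => hle p p.2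
  refine ⟨range g, range_subset_iff.2 hgs, countable_range g,
    le_antisymm (biSup_mono (range_subset_iff.2 hgs)) ?_⟩
  calc ⨆ i ∈ s, f i ≤ sSup P := iSup₂_le fun i hi =>
        hsup ▸ le_sSup (subset_lowerClosure (mem_image_of_mem f hi))
    _ ≤ ⨆ i ∈ range g, f i := sSup_le fun p hp =>
        (hg ⟨p, hp⟩).trans (le_biSup f (mem_range_self _))

theorem CCC.exists_countable_biInf_eq (hB : CCC B) {ι : Type*} (f : ι → B) (s : Set ι) :
    ∃ t ⊆ s, t.Countable ∧ ⨅ i ∈ t, f i = ⨅ i ∈ s, f i := by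
  obtain ⟨t, hts, ht, hsup⟩ := hB.exists_countable_biSup_eq (fun i => (f i)ᶜ) s
  exact ⟨t, hts, ht, compl_injective (by simpa only [compl_iInf] using hsup)⟩

theorem CCC.exists_seq_iSup_eq (hB : CCC B) {ι : Type*} [Nonempty ι] (f : ι → B) :
    ∃ c : ℕ → ι, ⨆ k, f (c k) = ⨆ i, f i := by
  obtain ⟨t, -, ht, hsup⟩ := hB.exists_countable_biSup_eq f univ
  obtain ⟨c, hc⟩ := (ht.insert (Classical.arbitrary ι)).exists_eq_range (insert_nonempty _ _)
  refine ⟨c, le_antisymm (iSup_le fun k => le_iSup f (c k)) ?_⟩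
  rw [← iSup_univ (f := f), ← hsup, ← iSup_range (g := f), ← hc]
  exact biSup_mono (subset_insert _ t)

theorem CCC.exists_seq_iInf_eq (hB : CCC B) {ι : Type*} [Nonempty ι] (f : ι → B) :
    ∃ c : ℕ → ι, ⨅ k, f (c k) = ⨅ i, f i := by
  obtain ⟨c, hc⟩ := hB.exists_seq_iSup_eq fun i => (f i)ᶜ
  exact ⟨c, compl_injective (by simpa only [compl_iInf] using hc)⟩

theorem CCC.eventually_le_limsup (hB : CCC B) {ι : Type*} (l : Filter ι) [CountableInterFilter l]
    (x : ι → B) : ∀ᶠ i in l, x i ≤ limsup x l := by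
  obtain ⟨t, hts, ht, hinf⟩ :=
    hB.exists_countable_biInf_eq (fun a : B => a) {a | ∀ᶠ i in l, x i ≤ a}
  rw [limsup_eq, sInf_eq_iInf, ← hinf]
  filter_upwards [(eventually_countable_ball ht).2 hts] with i hi
  exact le_iInf₂ hi

-- Zorn's lemma for the relation `b ≤ a ∧ L b < L a`: a chain without a last element is dominated
-- by a countable subfamily computing the infimum of its `L`-values.
theorem CCC.exists_forall_le_eq (hB : CCC B) {α : Type*} [Preorder α]
    (hα : ∀ s : Set α, s.Countable → IsChain (· ≤ ·) s → BddBelow s)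
    {L : α → B} (hL : Monotone L) : ∃ a, ∀ b ≤ a, L b = L a := by
  let r : α → α → Prop := fun a b => a = b ∨ b ≤ a ∧ L b < L a
  have : Std.Refl r := ⟨fun _ => Or.inl rfl⟩
  obtain ⟨a, ha⟩ : ∃ a, ∀ b, r a b → r b a := by
    refine exists_maximal_of_chains_bounded (fun c hc => ?_) ?_
    · by_cases hlast : ∃ m ∈ c, ∀ b ∈ c, r b m
      · exact hlast.imp fun m hm => hm.2
      obtain ⟨t, htc, ht, hinf⟩ := hB.exists_countable_biInf_eq L c
      have hdom : ∀ b ∈ c, ∃ d ∈ t, d ≤ b ∧ L d < L b := by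
        intro b hb
        by_contra! hnot
        refine hlast ⟨b, hb, fun b' hb' => ?_⟩
        by_contra hb'b
        obtain ⟨hle, hlt⟩ : b' ≤ b ∧ L b' < L b :=
          ((hc.total hb hb').resolve_right hb'b).resolve_left fun h => hb'b (Or.inl h.symm)
        refine hlt.not_ge ((le_iInf₂ fun d hd => ?_).trans (hinf.le.trans (biInf_le L hb')))
        rcases hc.total hb (htc hd) with (rfl | h) | (rfl | h)
        exacts [le_rfl, absurd h.2 (hnot d hd h.1), le_rfl, h.2.le]
      have hchain : IsChain (· ≤ ·) t := fun x hx y hy hxy =>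
        (hc (htc hx) (htc hy) hxy).symm.imp (fun h => (h.resolve_left hxy.symm).1)
          fun h => (h.resolve_left hxy).1
      obtain ⟨e, he⟩ := hα t ht hchain
      refine ⟨e, fun b hb => Or.inr ?_⟩
      obtain ⟨d, hd, hdb, hlt⟩ := hdom b hb
      exact ⟨(he hd).trans hdb, (hL (he hd)).trans_lt hlt⟩
    · rintro a b c (rfl | hab) (rfl | hbc)
      exacts [Or.inl rfl, Or.inr hbc, Or.inr hab, Or.inr ⟨hbc.1.trans hab.1, hbc.2.trans hab.2⟩]
  refine ⟨a, fun b hba => by_contra fun hne => ?_⟩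
  have hlt : L b < L a := (hL hba).lt_of_ne hne
  rcases ha b (Or.inr ⟨hba, hlt⟩) with h | h
  exacts [hne (congrArg L h), hlt.asymm h.2]

end CountableChainCondition

section WeakDistributivity

variable {B : Type u} [CompleteBooleanAlgebra B]

theorem WeaklyDistributive.exists_isExhaustion_forall_le (hwd : WeaklyDistributive B)
    (hB : CCC B) {q : ℕ → ℕ → B} (hq : ∀ n, IsExhaustion (q n)) :
    ∃ r, IsExhaustion r ∧ ∀ k n, ∃ j, r k ≤ q n j := by
  obtain ⟨Q, hQ, hfin⟩ := hwd (fun n => range (disjointed (q n)) \ {⊥}) fun n =>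
    ⟨(countable_range _).mono sdiff_subset, (hq n).isMaximalDisjointFamily_disjointed⟩
  have hle : ∀ a ∈ insert ⊥ Q, ∀ n, ∃ j, a ≤ q n j := by
    rintro a (rfl | ha) n
    · exact ⟨0, bot_le⟩
    refine exists_le_of_finite_inf_ne_bot (hq n).monotone ((hq n).iSup_eq_top ▸ le_top) ?_
    exact (hfin a ha n).subset fun p hp => ⟨⟨hp.1, fun h => hp.2 (h ▸ inf_bot_eq a)⟩, hp.2⟩
  obtain ⟨c, hc⟩ := ((hB Q hQ.prop).insert ⊥).exists_eq_range (insert_nonempty _ _)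
  refine ⟨partialSups c, ⟨(partialSups c).monotone, ?_⟩, fun k n => ?_⟩
  · rw [iSup_partialSups_eq, ← sSup_range, ← hc, sSup_insert, bot_sup_eq, hQ.sSup_eq_top]
  choose j hj using fun i => hle (c i) (hc ▸ mem_range_self i) n
  refine ⟨partialSups j k, partialSups_le _ _ _ fun i hi => ?_⟩
  exact (hj i).trans ((hq n).monotone (le_partialSups_of_le j hi))

theorem WeaklyDistributive.exists_isNull_diagonal (hwd : WeaklyDistributive B) (hB : CCC B)
    {ι : Type*} {l : Filter ι} [l.NeBot] {y : ℕ → ι → B} (hy : ∀ n, IsNull l (y n)) :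
    ∃ j : ℕ → ι, IsNull atTop fun n => y n (j n) := by
  choose q hq hqy using hy
  obtain ⟨r, hr, hrq⟩ := hwd.exists_isExhaustion_forall_le hB hq
  have hdisj : ∀ n, ∃ i, Disjoint (r n) (y n i) := fun n => by
    obtain ⟨j, hj⟩ := hrq n n
    exact ((hqy n j).mono fun i hi => hi.mono_left hj).exists
  choose j hj using hdisj
  exact ⟨j, r, hr, fun k =>
    (eventually_ge_atTop k).mono fun n hkn => (hj n).mono_left (hr.monotone hkn)⟩

end WeakDistributivity

section Neighbourhood

variable {α : Type*} [Order.Frame α] {U V : Set α}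

/-- `U` absorbs null sequences if every null sequence is eventually in `U`. -/
def AbsorbsNull (U : Set α) : Prop :=
  ∀ x : ℕ → α, IsNull atTop x → ∀ᶠ n in atTop, x n ∈ U

theorem exists_isNull_forall_notMem (hU : ¬ AbsorbsNull U) :
    ∃ x : ℕ → α, IsNull atTop x ∧ ∀ n, x n ∉ U := by
  simp only [AbsorbsNull, not_forall, not_eventually] at hU
  obtain ⟨x, hx, hxU⟩ := hU
  obtain ⟨φ, hφ, hφU⟩ := extraction_of_frequently_atTop hxU
  exact ⟨x ∘ φ, hx.comp_tendsto hφ.tendsto_atTop, hφU⟩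

/-- A neighbourhood (of `⊥`): a lower set which absorbs null sequences. -/
structure IsNbhd (U : Set α) : Prop where
  isLowerSet : IsLowerSet U
  absorbsNull : AbsorbsNull U

theorem isNbhd_univ : IsNbhd (univ : Set α) :=
  ⟨isLowerSet_univ, fun _ _ => .of_forall mem_univ⟩

theorem IsNbhd.bot_mem (hU : IsNbhd U) : ⊥ ∈ U :=
  (hU.absorbsNull _ (isNull_bot atTop)).exists.choose_spec

theorem IsNbhd.inter (hU : IsNbhd U) (hV : IsNbhd V) : IsNbhd (U ∩ V) :=
  ⟨hU.isLowerSet.inter hV.isLowerSet, fun x hx => (hU.absorbsNull x hx).and (hV.absorbsNull x hx)⟩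

theorem IsNbhd.biInter {ι : Type*} {s : Set ι} (hs : s.Finite) {U : ι → Set α}
    (hU : ∀ i ∈ s, IsNbhd (U i)) : IsNbhd (⋂ i ∈ s, U i) where
  isLowerSet := isLowerSet_iInter₂ fun i hi => (hU i hi).isLowerSet
  absorbsNull x hx := by
    simpa only [mem_iInter] using hs.eventually_all.2 fun i hi => (hU i hi).absorbsNull x hx

theorem AbsorbsNull.isNbhd_setOf_Iic_subset (hU : AbsorbsNull U) : IsNbhd {a | Iic a ⊆ U} where
  isLowerSet _ _ hba ha := (Iic_subset_Iic.2 hba).trans ha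
  absorbsNull := by
    by_contra h
    obtain ⟨x, hx, hxU⟩ := exists_isNull_forall_notMem h
    choose y hyx hyU using fun n => not_subset.1 (hxU n)
    obtain ⟨n, hn⟩ := (hU y (hx.mono hyx)).exists
    exact hyU n hn

/-- An open neighbourhood: one which is a neighbourhood of each of its members. -/
structure IsOpenNbhd (U : Set α) : Prop extends IsNbhd U where
  preimage_sup : ∀ a ∈ U, IsNbhd ((a ⊔ ·) ⁻¹' U)

end Neighbourhood

section OpenNeighbourhood

variable {B : Type u} [CompleteBooleanAlgebra B] {U : Set B}

theorem IsNbhd.setOf_isNbhd_preimage_sup (hB : CCC B) (hwd : WeaklyDistributive B)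
    (hU : IsNbhd U) : IsNbhd {v | IsNbhd ((v ⊔ ·) ⁻¹' U)} := by
  have hlower : ∀ v, IsLowerSet ((v ⊔ ·) ⁻¹' U) := fun v _ _ h hv =>
    hU.isLowerSet (sup_le_sup_left h v) hv
  refine ⟨fun v w hwv hv => ⟨hlower w, fun x hx => ?_⟩, ?_⟩
  · exact (hv.absorbsNull x hx).mono fun n hn => hU.isLowerSet (sup_le_sup_right hwv _) hn
  by_contra h
  obtain ⟨x, hx, hxU⟩ := exists_isNull_forall_notMem h
  choose y hy hyU using fun n => exists_isNull_forall_notMem fun h => hxU n ⟨hlower (x n), h⟩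
  obtain ⟨j, hj⟩ := hwd.exists_isNull_diagonal hB hy
  obtain ⟨n, hn⟩ := (hU.absorbsNull _ (hx.sup hj)).exists
  exact hyU n (j n) hn

theorem IsNbhd.exists_isOpenNbhd (hB : CCC B) (hwd : WeaklyDistributive B) (hU : IsNbhd U) :
    ∃ V ⊆ U, IsOpenNbhd V := by
  refine ⟨{v | IsNbhd ((v ⊔ ·) ⁻¹' U)}, fun v hv => ?_,
    hU.setOf_isNbhd_preimage_sup hB hwd, fun a ha => ?_⟩
  · simpa only [mem_preimage, sup_bot_eq] using hv.bot_mem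
  · simpa only [preimage_ofPred_eq, preimage_preimage, sup_assoc] using
      ha.setOf_isNbhd_preimage_sup hB hwd

end OpenNeighbourhood

section Stable

variable {B : Type u} [CompleteBooleanAlgebra B]

/-- A stable sequence: up to a null sequence, it lies below the supremum of each of its
subsequences. -/
def IsStable (x : ℕ → B) : Prop :=
  ∀ ψ : ℕ → ℕ, StrictMono ψ → IsNull atTop fun n => x n \ ⨆ m, x (ψ m)

theorem IsStable.comp {x : ℕ → B} (hx : IsStable x) {φ : ℕ → ℕ} (hφ : StrictMono φ) :
    IsStable (x ∘ φ) :=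
  fun ψ hψ => (hx (φ ∘ ψ) (hφ.comp hψ)).comp_tendsto hφ.tendsto_atTop

theorem bddBelow_of_countable_of_isChain {ι : Type*} {l : Filter ι} [l.NeBot]
    [l.IsCountablyGenerated] {s : Set {F : Filter ι // F.NeBot ∧ F.IsCountablyGenerated ∧ F ≤ l}}
    (hs : s.Countable) (hchain : IsChain (· ≤ ·) s) : BddBelow s := by
  rcases s.eq_empty_or_nonempty with rfl | hne
  · exact ⟨⟨l, inferInstance, inferInstance, le_rfl⟩, fun _ h => h.elim⟩
  have := hs.to_subtype
  have := hne.to_subtype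
  have hneBot : ∀ F : s, F.1.1.NeBot := fun F => F.1.2.1
  have : ∀ F : s, F.1.1.IsCountablyGenerated := fun F => F.1.2.2.1
  have hdir : Directed (· ≥ ·) fun F : s => F.1.1 := fun F G =>
    (hchain.total F.2 G.2).elim (fun h => ⟨F, le_rfl, h⟩) fun h => ⟨G, h, le_rfl⟩
  obtain ⟨G, hG⟩ := hne
  exact ⟨⟨⨅ F : s, F.1.1, iInf_neBot_of_directed' hdir hneBot, iInf.isCountablyGenerated _,
    (iInf_le (fun F : s => F.1.1) ⟨G, hG⟩).trans G.2.2.2⟩,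
    fun F hF => iInf_le (fun F : s => F.1.1) ⟨F, hF⟩⟩

-- The limit superior along a filter can only decrease when the filter is refined, and by ccc it
-- becomes constant; a subsequence converging along such a filter is stable.
theorem CCC.exists_isStable_comp (hB : CCC B) (x : ℕ → B) :
    ∃ φ : ℕ → ℕ, StrictMono φ ∧ IsStable (x ∘ φ) := by
  obtain ⟨⟨F, hF, hFc, hFtop⟩, hconst⟩ := hB.exists_forall_le_eq
    (α := {F : Filter ℕ // F.NeBot ∧ F.IsCountablyGenerated ∧ F ≤ atTop})
    (fun _ => bddBelow_of_countable_of_isChain) (L := fun F => limsup x F.1)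
    fun _ _ h => limsup_le_limsup_of_le h
  obtain ⟨φ, hφ⟩ := exists_seq_tendsto F
  obtain ⟨θ, hθ, hφθ⟩ := strictMono_subseq_of_tendsto_atTop (hφ.mono_right hFtop)
  have hφθF : Tendsto (φ ∘ θ) atTop F := hφ.comp hθ.tendsto_atTop
  refine ⟨φ ∘ θ, hφθ, fun ψ hψ => ((isNull_sdiff_limsup F x).comp_tendsto hφθF).mono fun n =>
    sdiff_le_sdiff_left ?_⟩
  have hle : map ((φ ∘ θ) ∘ ψ) atTop ≤ F := hφθF.comp hψ.tendsto_atTop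
  calc limsup x F = limsup x (map ((φ ∘ θ) ∘ ψ) atTop) :=
        (hconst ⟨_, inferInstance, inferInstance, hle.trans hFtop⟩ hle).symm
    _ ≤ ⨆ m, (x ∘ φ ∘ θ) (ψ m) :=
      limsup_le_iSup (u := fun m => (x ∘ φ ∘ θ) (ψ m))

theorem CCC.exists_forall_isStable_comp (hB : CCC B) {ι : Type*} [Finite ι] (x : ι → ℕ → B) :
    ∃ φ : ℕ → ℕ, StrictMono φ ∧ ∀ i, IsStable (x i ∘ φ) := by
  classical
  cases nonempty_fintype ι
  suffices ∀ s : Finset ι, ∃ φ : ℕ → ℕ, StrictMono φ ∧ ∀ i ∈ s, IsStable (x i ∘ φ) by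
    simpa only [Finset.mem_univ, forall_const] using this Finset.univ
  intro s
  induction s using Finset.induction_on with
  | empty => exact ⟨id, strictMono_id, by simp⟩
  | insert i s _ ih =>
    obtain ⟨φ, hφ, hs⟩ := ih
    obtain ⟨θ, hθ, hi⟩ := hB.exists_isStable_comp (x i ∘ φ)
    exact ⟨φ ∘ θ, hφ.comp hθ, Finset.forall_mem_insert _ _ _ |>.2
      ⟨hi, fun j hj => (hs j hj).comp hθ⟩⟩

theorem exists_isNull_iSup_sdiff_iSup {ι : Type*} [Finite ι] [Nonempty ι] {f : ℕ → ι → B}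
    (hf : ∀ i, IsStable fun n => f n i) :
    ∃ σ : ℕ → ι, IsNull atTop fun n => (⨆ i, f n i) \ ⨆ k, f k (σ k) := by
  obtain ⟨σ, hσ⟩ := exists_seq_forall_frequently_eq ι
  refine ⟨σ, ?_⟩
  simp only [iSup_sdiff_eq]
  refine IsNull.iSup fun i => ?_
  obtain ⟨ψ, hψ, hσψ⟩ := extraction_of_frequently_atTop (hσ i)
  refine (hf i ψ hψ).mono fun n => sdiff_le_sdiff_left (iSup_le fun m => ?_)
  exact (hσψ m) ▸ le_iSup (fun k => f k (σ k)) (ψ m)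

end Stable

section TwoFold

variable {α : Type*} [Order.Frame α] {B : Type u} [CompleteBooleanAlgebra B]

/-- The elements lying below the join of two members of `U`. -/
def twoFold (U : Set α) : Set α :=
  {w | ∃ u ∈ U, ∃ v ∈ U, w ≤ u ⊔ v}

theorem isNbhd_twoFold {U : Set α} (hU : IsNbhd U) : IsNbhd (twoFold U) where
  isLowerSet := fun _ _ hba ⟨u, hu, v, hv, h⟩ => ⟨u, hu, v, hv, hba.trans h⟩
  absorbsNull x hx :=
    (hU.absorbsNull x hx).mono fun n hn => ⟨x n, hn, x n, hn, le_sup_left⟩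

theorem IsOpenNbhd.exists_subset_forall_sup_mem (hB : CCC B) (hwd : WeaklyDistributive B)
    {V : Set B} (hV : IsOpenNbhd V) {ι : Type*} [Finite ι] {f : ι → B} (hf : ∀ i, f i ∈ V) :
    ∃ W ⊆ V, IsOpenNbhd W ∧ ∀ i, ∀ w ∈ W, f i ⊔ w ∈ V := by
  obtain ⟨W, hWV, hW⟩ := (hV.toIsNbhd.inter
    (IsNbhd.biInter finite_univ fun i _ => hV.preimage_sup _ (hf i))).exists_isOpenNbhd hB hwd
  exact ⟨W, fun w hw => (hWV hw).1, hW, fun i w hw => mem_iInter₂.1 (hWV hw).2 i (mem_univ i)⟩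

theorem IsNbhd.exists_seq_forall_partialSups_mem (hB : CCC B) (hwd : WeaklyDistributive B)
    {U : Set B} (hU : IsNbhd U) {ι : Type*} [Finite ι] {p : (ι → B) → Prop}
    (hp : ∀ V, IsNbhd V → ∃ f : ι → B, (∀ i, f i ∈ V) ∧ p f) :
    ∃ f : ℕ → ι → B, (∀ n, p (f n)) ∧ ∀ φ, StrictMono φ → ∀ (σ : ℕ → ι) (n : ℕ),
      partialSups (fun k => f (φ k) (σ k)) n ∈ U := by
  obtain ⟨U', hU'U, hU'⟩ := hU.exists_isOpenNbhd hB hwd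
  choose f hfV hpf using fun V : {V : Set B // IsOpenNbhd V} => hp V.1 V.2.toIsNbhd
  choose next hsub hnext hsup using
    fun V : {V : Set B // IsOpenNbhd V} => V.2.exists_subset_forall_sup_mem hB hwd (hfV V)
  let V : ℕ → {V : Set B // IsOpenNbhd V} := fun n => (fun V => ⟨next V, hnext V⟩)^[n] ⟨U', hU'⟩
  have hV : ∀ n, (V (n + 1)).1 = next (V n) := fun n =>
    congrArg Subtype.val (Function.iterate_succ_apply' _ n _)
  have hanti : Antitone fun n => (V n).1 := antitone_nat_of_succ_le fun n => hV n ▸ hsub (V n)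
  refine ⟨fun n => f (V n), fun n => hpf (V n), fun φ hφ σ n =>
    hU'U (hanti (Nat.zero_le (φ 0)) ?_)⟩
  refine partialSups_mem_of_sup_mem (V := fun k => (V (φ k)).1) (fun k => hfV _ _)
    (fun k w hw => hsup _ _ _ ?_) n
  exact hV (φ k) ▸ hanti (hφ k.lt_succ_self) hw

theorem IsNbhd.exists_forall_iSup_mem_twoFold (hB : CCC B) (hwd : WeaklyDistributive B)
    {U : Set B} (hU : IsNbhd U) (ι : Type*) [Finite ι] [Nonempty ι] :
    ∃ V, IsNbhd V ∧ ∀ f : ι → B, (∀ i, f i ∈ V) → ⨆ i, f i ∈ twoFold U := by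
  by_contra! hcon
  obtain ⟨f, hfU, hf⟩ := hU.exists_seq_forall_partialSups_mem hB hwd hcon
  obtain ⟨φ, hφ, hstable⟩ := hB.exists_forall_isStable_comp fun i n => f n i
  obtain ⟨σ, hσ⟩ := exists_isNull_iSup_sdiff_iSup (f := fun n => f (φ n)) hstable
  set t : ℕ → B := fun k => f (φ k) (σ k)
  obtain ⟨n, hn⟩ :=
    (hU.absorbsNull _ (hσ.sup (isNull_iSup_sdiff_partialSups t))).exists
  exact hfU (φ n) ⟨partialSups t n, hf φ hφ σ n, _, hn,
    sdiff_le_iff.1 (sdiff_triangle _ (⨆ k, t k) _)⟩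

end TwoFold

section NullIdeal

variable {α : Type*} [Order.Frame α] {S : Type*}

/-- The ideal of countable sets of indices along which the family `g` is null. -/
def nullIdeal (g : S → α) : Order.Ideal (Set S) where
  carrier := {A | A.Countable ∧ IsNull (cofinite ⊓ 𝓟 A) g}
  lower' _ _ hle := fun ⟨hA, hnull⟩ =>
    ⟨hA.mono hle, hnull.mono_filter (inf_le_inf_left _ (principal_mono.2 hle))⟩
  nonempty' := ⟨∅, countable_empty, _, isExhaustion_top, fun _ => by
    simp only [principal_empty, inf_bot_eq, eventually_bot]⟩
  directed' := fun A hA A' hA' => ⟨A ∪ A',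
    ⟨hA.1.union hA'.1, by
      simpa only [← inf_sup_left, sup_principal] using hA.2.sup_filter hA'.2⟩,
    subset_union_left, subset_union_right⟩

theorem eventually_eq_bot_of_forall_finite_inter {g : S → α} {T : Set S}
    (hT : ∀ A ∈ nullIdeal g, (T ∩ A).Finite) {y : ℕ → S} (hyT : ∀ n, y n ∈ T)
    (hy : IsNull atTop (g ∘ y)) : ∀ᶠ n in atTop, g (y n) = ⊥ := by
  have hmap : IsNull (map y cofinite) g := Nat.cofinite_eq_atTop ▸ hy
  have hmem : range y ∈ nullIdeal g :=
    ⟨countable_range y, hmap.mono_filter (cofinite_inf_principal_range_le_map y)⟩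
  have hfin : (range y).Finite :=
    (hT _ hmem).subset (subset_inter (range_subset_iff.2 hyT) Subset.rfl)
  exact hy.eventually_eq_bot (range_comp g y ▸ hfin.image g)

end NullIdeal

section Dichotomy

variable {B : Type u} [CompleteBooleanAlgebra B]

theorem isPIdeal_nullIdeal (hB : CCC B) (hwd : WeaklyDistributive B) {S : Type*} (g : S → B) :
    IsPIdeal (nullIdeal g) := by
  intro A hA
  choose q hq hqA using fun n => (hA n).2
  obtain ⟨r, hr, hrq⟩ := hwd.exists_isExhaustion_forall_le hB hq
  have hfin : ∀ k n, {p ∈ A n | ¬ Disjoint (r k) (g p)}.Finite := fun k n => by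
    obtain ⟨j, hj⟩ := hrq k n
    exact eventually_cofinite_inf_principal.1 ((hqA n j).mono fun p hp => hp.mono_left hj)
  refine ⟨⋃ n, {p ∈ A n | Disjoint (r n) (g p)},
    ⟨countable_iUnion fun n => (hA n).1.mono (sep_subset _ _), r, hr, fun k => ?_⟩, fun n => ?_⟩
  · refine eventually_cofinite_inf_principal.2
      (((finite_Iio k).biUnion fun n _ => hfin k n).subset fun p ⟨hp, hpk⟩ => ?_)
    obtain ⟨n, hpn, hdisj⟩ := mem_iUnion.1 hp
    have hnk : n < k := not_le.1 fun hkn => hpk (hdisj.mono_left (hr.monotone hkn))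
    exact mem_biUnion (x := n) hnk ⟨hpn, hpk⟩
  · exact (hfin n n).subset fun p hp => ⟨hp.1, fun hdisj => hp.2 (mem_iUnion.2 ⟨n, hp.1, hdisj⟩)⟩

theorem CCC.exists_seq_countable_limsup_le_biSup (hB : CCC B) {S : Type*} (g : S → B)
    (Y : Set S) : ∃ F : ℕ → Set S, Pairwise (Function.onFun Disjoint F) ∧
      ∀ n, F n ⊆ Y ∧ (F n).Countable ∧ limsup g (cocountable ⊓ 𝓟 Y) ≤ ⨆ p ∈ F n, g p := by
  suffices h : ∀ s : Finset (Set S), (∀ E ∈ s, E.Countable) → ∃ F : Set S,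
      (F ⊆ Y ∧ F.Countable ∧ limsup g (cocountable ⊓ 𝓟 Y) ≤ ⨆ p ∈ F, g p) ∧
        ∀ E ∈ s, Disjoint E F by
    obtain ⟨F, hF, hdisj⟩ := exists_seq_of_forall_finset_exists' _ Disjoint
      fun s hs => h s fun E hE => (hs E hE).2.1
    exact ⟨F, hdisj, hF⟩
  intro s hs
  have hE : (⋃ E ∈ s, E).Countable := s.countable_toSet.biUnion hs
  obtain ⟨F, hFY, hF, hsup⟩ := hB.exists_countable_biSup_eq g (Y \ ⋃ E ∈ s, E)
  refine ⟨F, ⟨hFY.trans sdiff_subset, hF, hsup ▸ limsup_le_of_le (by isBoundedDefault) ?_⟩,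
    fun E hEs => disjoint_left.2 fun p hpE hpF => (hFY hpF).2 (mem_biUnion hEs hpE)⟩
  filter_upwards [mem_inf_of_left (mem_cocountable.2 ((compl_compl (⋃ E ∈ s, E)).symm ▸ hE)),
    mem_inf_of_right (mem_principal_self Y)] with p hpE hpY
  exact le_biSup g ⟨hpY, hpE⟩

theorem CCC.countable_of_forall_mem_nullIdeal (hB : CCC B) {S : Type*} {g : S → B} {Y : Set S}
    (hY : ∀ A ⊆ Y, A.Countable → A ∈ nullIdeal g) : {p ∈ Y | g p ≠ ⊥}.Countable := by
  have : CountableInterFilter (cocountable : Filter S) :=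
    CardinalInterFilter.toCountableInterFilter _ Cardinal.aleph0_lt_aleph_one
  suffices hbot : limsup g (cocountable ⊓ 𝓟 Y) = ⊥ by
    have hev := hB.eventually_le_limsup (cocountable ⊓ 𝓟 Y) g
    rw [hbot, eventually_inf_principal] at hev
    simpa only [compl_ofPred, Classical.not_imp, le_bot_iff] using mem_cocountable.1 hev
  by_contra hne
  obtain ⟨F, hdisj, hF⟩ := hB.exists_seq_countable_limsup_le_biSup g Y
  obtain ⟨-, q, hq, hqF⟩ :=
    hY (⋃ n, F n) (iUnion_subset fun n => (hF n).1) (countable_iUnion fun n => (hF n).2.1)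
  obtain ⟨k, hk⟩ : ∃ k, ¬ Disjoint (q k) (limsup g (cocountable ⊓ 𝓟 Y)) := by
    by_contra! h
    exact hne (hq.eq_bot_of_forall_disjoint h)
  have hmeet : ∀ n, ∃ p ∈ F n, ¬ Disjoint (q k) (g p) := fun n => by
    by_contra! h
    exact hk ((disjoint_iSup₂_iff.2 h).mono_right (hF n).2.2)
  choose p hpF hpk using hmeet
  have hinj : Function.Injective p := fun m n hmn => by
    by_contra h
    exact disjoint_left.1 (hdisj h) (hpF m) (hmn ▸ hpF n)
  refine infinite_range_of_injective hinj
    ((eventually_cofinite_inf_principal.1 (hqF k)).subset (range_subset_iff.2 fun n => ?_))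
  exact ⟨mem_iUnion.2 ⟨n, hpF n⟩, hpk n⟩

-- The factor `ℕ` only serves to make the index set of the ideal infinite.
theorem PIdealDichotomy.exists_isNbhd_seq (hstar : PIdealDichotomy.{u}) (hB : CCC B)
    (hwd : WeaklyDistributive B) :
    ∃ U : ℕ → Set B, (∀ n, IsNbhd (U n)) ∧ ∀ a, (∀ n, a ∈ U n) → a = ⊥ := by
  rcases hstar (B × ℕ) (nullIdeal Prod.fst) (fun A hA => hA.1)
    (isPIdeal_nullIdeal hB hwd Prod.fst) with ⟨Y, hYc, hY⟩ | ⟨T, hT, hfin⟩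
  · refine absurd (((hB.countable_of_forall_mem_nullIdeal hY).union
      (countable_range fun n : ℕ => ((⊥ : B), n))).mono fun p hp => ?_) hYc
    by_cases hbot : p.1 = ⊥
    · exact Or.inr ⟨p.2, Prod.ext hbot.symm rfl⟩
    · exact Or.inl ⟨hp, hbot⟩
  have habs : ∀ n, AbsorbsNull {b : B | b = ⊥ ∨ (b, 0) ∉ T n} := fun n => by
    by_contra h
    obtain ⟨x, hx, hxT⟩ := exists_isNull_forall_notMem h
    simp only [mem_ofPred_eq, not_or, not_not] at hxT
    obtain ⟨j, hj⟩ := (eventually_eq_bot_of_forall_finite_inter (hfin n)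
      (fun j => (hxT j).2) hx).exists
    exact (hxT j).1 hj
  refine ⟨fun n => _, fun n => (habs n).isNbhd_setOf_Iic_subset, fun a ha => ?_⟩
  obtain ⟨n, hn⟩ := mem_iUnion.1 (hT ▸ mem_univ (a, 0))
  exact (ha n self_mem_Iic).resolve_right (not_not_intro hn)

end Dichotomy

section Separation

variable {B : Type u} [CompleteBooleanAlgebra B]

theorem IsNbhd.exists_isNull_forall_sdiff_mem {U : Set B} (hU : IsNbhd U) {a : B}
    (ha : ∀ V, IsNbhd V → a ∈ twoFold V) : ∃ v : ℕ → B, IsNull atTop v ∧ ∀ n, a \ v n ∈ U := by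
  have hnot : ¬ AbsorbsNull {v | a \ v ∉ U} := fun h => by
    obtain ⟨u, hu, v, hv, hle⟩ := ha _ (hU.inter h.isNbhd_setOf_Iic_subset)
    exact hv.2 self_mem_Iic (hU.isLowerSet (sdiff_le_iff'.2 hle) hu.1)
  obtain ⟨v, hv, hvU⟩ := exists_isNull_forall_notMem hnot
  exact ⟨v, hv, fun n => not_not.1 (hvU n)⟩

theorem exists_isNbhd_notMem_twoFold (hB : CCC B) (hwd : WeaklyDistributive B) {U : ℕ → Set B}
    (hU : ∀ n, IsNbhd (U n)) (hbot : ∀ a, (∀ n, a ∈ U n) → a = ⊥) {a : B} (ha : a ≠ ⊥) :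
    ∃ V, IsNbhd V ∧ a ∉ twoFold V := by
  by_contra! hcon
  choose v hv hvU using fun n => (hU n).exists_isNull_forall_sdiff_mem hcon
  choose q hq hqv using hv
  have hqU : ∀ n j, q n j ⊓ a ∈ U n := fun n j => by
    obtain ⟨i, hi⟩ := (hqv n j).exists
    exact (hU n).isLowerSet (le_sdiff.2 ⟨inf_le_right, hi.mono_left inf_le_left⟩) (hvU n i)
  obtain ⟨r, hr, hrq⟩ := hwd.exists_isExhaustion_forall_le hB hq
  refine ha (hr.eq_bot_of_forall_disjoint fun k => disjoint_iff.2 (hbot _ fun n => ?_))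
  obtain ⟨j, hj⟩ := hrq k n
  exact (hU n).isLowerSet (inf_le_inf_right a hj) (hqU n j)

end Separation

section Chain

/-- A sequence of neighbourhoods of `⊥` each of which contains all joins of three members of the
next: the analogue of the sequences of entourages from which uniformities are metrized. -/
structure IsNbhdChain {α : Type*} [Order.Frame α] (W : ℕ → Set α) : Prop where
  isNbhd : ∀ n, IsNbhd (W n)
  sup_sup_mem : ∀ n, ∀ a ∈ W (n + 1), ∀ b ∈ W (n + 1), ∀ c ∈ W (n + 1), a ⊔ b ⊔ c ∈ W n

section Frame

variable {α : Type*} [Order.Frame α] {W : ℕ → Set α}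

theorem isNbhdChain_univ : IsNbhdChain (fun _ => univ : ℕ → Set α) :=
  ⟨fun _ => isNbhd_univ, fun _ _ _ _ _ _ _ => mem_univ _⟩

theorem IsNbhdChain.sup_mem (hW : IsNbhdChain W) {n : ℕ} {a b : α} (ha : a ∈ W (n + 1))
    (hb : b ∈ W (n + 1)) : a ⊔ b ∈ W n := by
  simpa only [sup_bot_eq] using hW.sup_sup_mem n a ha b hb ⊥ (hW.isNbhd (n + 1)).bot_mem

theorem IsNbhdChain.antitone (hW : IsNbhdChain W) : Antitone W :=
  antitone_nat_of_succ_le fun _ _ ha => by simpa only [sup_idem] using hW.sup_mem ha ha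

theorem IsNbhdChain.iInter_Iic {W : ℕ → ℕ → Set α} (hW : ∀ i, IsNbhdChain (W i)) :
    IsNbhdChain fun n => ⋂ i ∈ Iic n, W i n where
  isNbhd n := IsNbhd.biInter (finite_Iic n) fun i _ => (hW i).isNbhd n
  sup_sup_mem n a ha b hb c hc := by
    simp only [mem_iInter] at ha hb hc ⊢
    have hle : ∀ i ∈ Iic n, i ∈ Iic (n + 1) := fun i hi => Iic_subset_Iic.2 n.le_succ hi
    exact fun i hi => (hW i).sup_sup_mem n a (ha i (hle i hi)) b (hb i (hle i hi))
      c (hc i (hle i hi))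

end Frame

variable {B : Type u} [CompleteBooleanAlgebra B]

theorem IsNbhd.exists_forall_sup_sup_mem_twoFold (hB : CCC B) (hwd : WeaklyDistributive B)
    {U : Set B} (hU : IsNbhd U) : ∃ V, IsNbhd V ∧
      ∀ a ∈ twoFold V, ∀ b ∈ twoFold V, ∀ c ∈ twoFold V, a ⊔ b ⊔ c ∈ twoFold U := by
  obtain ⟨V, hV, hsup⟩ := hU.exists_forall_iSup_mem_twoFold hB hwd (Fin 3 × Fin 2)
  refine ⟨V, hV, ?_⟩
  rintro a ⟨a₁, ha₁, a₂, ha₂, ha⟩ b ⟨b₁, hb₁, b₂, hb₂, hb⟩ c ⟨c₁, hc₁, c₂, hc₂, hc⟩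
  let f : Fin 3 × Fin 2 → B := fun i => !![a₁, a₂; b₁, b₂; c₁, c₂] i.1 i.2
  have hfV : ∀ i, f i ∈ V := by
    rintro ⟨i, j⟩
    fin_cases i <;> fin_cases j <;> assumption
  have hrow : ∀ i, f (i, 0) ⊔ f (i, 1) ≤ ⨆ i, f i := fun i => sup_le (le_iSup f _) (le_iSup f _)
  exact (isNbhd_twoFold hU).isLowerSet
    (sup_le (sup_le (ha.trans (hrow 0)) (hb.trans (hrow 1))) (hc.trans (hrow 2))) (hsup f hfV)

theorem IsNbhd.exists_isNbhdChain (hB : CCC B) (hwd : WeaklyDistributive B) {U : Set B}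
    (hU : IsNbhd U) : ∃ W, IsNbhdChain W ∧ W 0 = twoFold U := by
  choose next hnext hsup using
    fun V : {V : Set B // IsNbhd V} => V.2.exists_forall_sup_sup_mem_twoFold hB hwd
  let V : ℕ → {V : Set B // IsNbhd V} := fun n => (fun V => ⟨next V, hnext V⟩)^[n] ⟨U, hU⟩
  refine ⟨fun n => twoFold (V n).1, ⟨fun n => isNbhd_twoFold (V n).2, fun n => ?_⟩, rfl⟩
  simpa only [V, Function.iterate_succ_apply'] using hsup (V n)

theorem IsNbhdChain.sSup_iInter_mem (hB : CCC B) {W : ℕ → Set B} (hW : IsNbhdChain W) (n : ℕ) :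
    sSup (⋂ n, W n) ∈ W n := by
  have : Nonempty ↥(⋂ n, W n) := ⟨⟨⊥, mem_iInter.2 fun n => (hW.isNbhd n).bot_mem⟩⟩
  obtain ⟨c, hc⟩ := hB.exists_seq_iSup_eq (Subtype.val : ↥(⋂ n, W n) → B)
  have hsup : ∀ k, partialSups (fun k => (c k).1) k ∈ ⋂ n, W n :=
    partialSups_mem_of_sup_mem (V := fun _ => ⋂ n, W n) (fun k => (c k).2) fun k w hw =>
      mem_iInter.2 fun _ => hW.sup_mem (mem_iInter.1 (c k).2 _) (mem_iInter.1 hw _)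
  obtain ⟨k, hk⟩ := ((hW.isNbhd (n + 1)).absorbsNull _
    (isNull_iSup_sdiff_partialSups fun k => (c k).1)).exists
  rw [hc, ← sSup_eq_iSup'] at hk
  exact (hW.isNbhd n).isLowerSet le_sup_sdiff (hW.sup_mem (mem_iInter.1 (hsup k) _) hk)

theorem exists_isNbhdChain_forall_eq_bot (hB : CCC B)
    (h : ∀ a : B, a ≠ ⊥ → ∃ W, IsNbhdChain W ∧ a ∉ W 0) :
    ∃ W : ℕ → Set B, IsNbhdChain W ∧ ∀ a, (∀ n, a ∈ W n) → a = ⊥ := by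
  let core : {W : ℕ → Set B // IsNbhdChain W} → B := fun W => sSup (⋂ n, W.1 n)
  have hcore : ⨅ W, core W = ⊥ := by
    by_contra hne
    obtain ⟨W, hW, hnot⟩ := h _ hne
    exact hnot ((hW.isNbhd 0).isLowerSet (iInf_le core ⟨W, hW⟩) (hW.sSup_iInter_mem hB 0))
  have : Nonempty {W : ℕ → Set B // IsNbhdChain W} := ⟨⟨_, isNbhdChain_univ⟩⟩
  obtain ⟨W, hW⟩ := hB.exists_seq_iInf_eq core
  refine ⟨_, .iInter_Iic fun i => (W i).2, fun a ha => ?_⟩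
  rw [← le_bot_iff, ← hcore, ← hW]
  refine le_iInf fun i => le_sSup (mem_iInter.2 fun n => ?_)
  exact (W i).2.antitone (le_max_right i n) (mem_iInter₂.1 (ha (max i n)) i (le_max_left i n))

end Chain

section Metrization

theorem dist_map_le_dist_ofPreNNDist {X Y : Type*} [PseudoMetricSpace Y] {d : X → X → ℝ≥0}
    (hself : ∀ x, d x x = 0) (hcomm : ∀ x y, d x y = d y x) {φ : X → Y}
    (hφ : ∀ x y, dist (φ x) (φ y) ≤ d x y) (x y : X) :
    dist (φ x) (φ y) ≤ (PseudoMetricSpace.ofPreNNDist d hself hcomm).dist x y := by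
  suffices ∀ l : List X, dist (φ x) (φ y) ≤ ((x :: l).zipWith d (l ++ [y])).sum by
    rw [PseudoMetricSpace.dist_ofPreNNDist, ← coe_nndist, NNReal.coe_le_coe]
    exact le_ciInf fun l => NNReal.coe_le_coe.1 (this l)
  intro l
  induction l generalizing x with
  | nil => simpa using hφ x y
  | cons z l ih =>
    simpa using (dist_triangle _ (φ z) _).trans (add_le_add (hφ x z) (ih z))

theorem symmDiff_sup_sup_right_le {α : Type*} [GeneralizedBooleanAlgebra α] (a b c : α) :
    symmDiff (a ⊔ c) (b ⊔ c) ≤ symmDiff a b := by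
  have h : ∀ x y : α, (x ⊔ c) \ (y ⊔ c) ≤ x \ y := fun x y => by
    rw [sup_sdiff, sdiff_eq_bot_iff.2 le_sup_right, sup_bot_eq]
    exact sdiff_le_sdiff_left le_sup_left
  exact sup_le_sup (h a b) (h b a)

variable {B : Type u} [CompleteBooleanAlgebra B]

theorem exists_isSubmeasure_of_le_two_mul_max {f : B → ℝ≥0} (hmono : Monotone f)
    (hbot : f ⊥ = 0) (hsup : ∀ a b c, f (a ⊔ b ⊔ c) ≤ 2 * max (f a) (max (f b) (f c))) :
    ∃ μ : B → ℝ, IsSubmeasure μ ∧ ∀ a, μ a ≤ f a ∧ f a ≤ 2 * μ a := by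
  have hself : ∀ x : B, f (symmDiff x x) = 0 := fun x => by rw [symmDiff_self, hbot]
  have hcomm : ∀ x y : B, f (symmDiff x y) = f (symmDiff y x) := fun x y => by
    rw [symmDiff_comm]
  let _ := PseudoMetricSpace.ofPreNNDist (fun x y => f (symmDiff x y)) hself hcomm
  have hdist_le : ∀ x y : B, dist x y ≤ f (symmDiff x y) :=
    PseudoMetricSpace.dist_ofPreNNDist_le _ hself hcomm
  have hle_dist : ∀ x y : B, f (symmDiff x y) ≤ 2 * dist x y :=
    PseudoMetricSpace.le_two_mul_dist_ofPreNNDist _ hself hcomm fun x₁ x₂ x₃ x₄ =>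
      (hmono ((symmDiff_triangle x₁ x₃ x₄).trans
        (sup_le_sup_right (symmDiff_triangle x₁ x₂ x₃) _))).trans (hsup _ _ _)
  have hmap : ∀ φ : B → B, (∀ x y, symmDiff (φ x) (φ y) ≤ symmDiff x y) →
      ∀ x y, dist (φ x) (φ y) ≤ dist x y := fun φ hφ =>
    dist_map_le_dist_ofPreNNDist hself hcomm fun x y =>
      (hdist_le _ _).trans (NNReal.coe_le_coe.2 (hmono (hφ x y)))
  refine ⟨fun a => dist ⊥ a, ⟨fun _ => dist_nonneg, dist_self ⊥, fun a b hab => ?_, fun a b => ?_⟩,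
    fun a => ⟨?_, ?_⟩⟩
  · have hinf := hmap (· ⊓ a) (fun x y => inf_symmDiff_distrib_right x y a ▸ inf_le_left) ⊥ b
    rwa [bot_inf_eq, inf_eq_right.2 hab] at hinf
  · have hsup_right := hmap (· ⊔ a) (fun x y => symmDiff_sup_sup_right_le x y a) ⊥ b
    rw [bot_sup_eq, sup_comm b] at hsup_right
    exact (dist_triangle ⊥ a _).trans (add_le_add_right hsup_right _)
  · simpa only [bot_symmDiff] using hdist_le ⊥ a
  · simpa only [bot_symmDiff] using hle_dist ⊥ a

end Metrization

section DyadicGauge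

/-- The gauge `a ↦ 2⁻ⁿ`, where `n` is least with `a ∉ W n`, of a sequence of sets; it is `0` on the
intersection of the sequence. -/
noncomputable def dyadicGauge {α : Type*} (W : ℕ → Set α) (a : α) : ℝ≥0 :=
  ⨆ n : {n // a ∉ W n}, (1 / 2) ^ n.1

theorem dyadicGauge_le_iff {α : Type*} {W : ℕ → Set α} {a : α} {r : ℝ≥0} :
    dyadicGauge W a ≤ r ↔ ∀ n, a ∉ W n → (1 / 2) ^ n ≤ r := by
  have hbdd : BddAbove (range fun n : {n // a ∉ W n} => (1 / 2 : ℝ≥0) ^ n.1) :=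
    ⟨1, forall_mem_range.2 fun n => pow_le_one₀ zero_le (NNReal.half_lt_self one_ne_zero).le⟩
  exact (ciSup_le_iff' hbdd).trans Subtype.forall

theorem pow_le_dyadicGauge {α : Type*} {W : ℕ → Set α} {a : α} {n : ℕ} (ha : a ∉ W n) :
    (1 / 2) ^ n ≤ dyadicGauge W a :=
  dyadicGauge_le_iff.1 le_rfl n ha

section Frame

variable {α : Type*} [Order.Frame α] {W : ℕ → Set α}

theorem IsNbhdChain.monotone_dyadicGauge (hW : IsNbhdChain W) : Monotone (dyadicGauge W) :=
  fun _ _ hab => dyadicGauge_le_iff.2 fun n ha => pow_le_dyadicGauge fun hb =>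
    ha ((hW.isNbhd n).isLowerSet hab hb)

theorem IsNbhdChain.dyadicGauge_bot (hW : IsNbhdChain W) : dyadicGauge W ⊥ = 0 :=
  le_antisymm (dyadicGauge_le_iff.2 fun n h => absurd (hW.isNbhd n).bot_mem h) zero_le

theorem IsNbhdChain.dyadicGauge_sup_sup_le (hW : IsNbhdChain W) (a b c : α) :
    dyadicGauge W (a ⊔ b ⊔ c) ≤
      2 * max (dyadicGauge W a) (max (dyadicGauge W b) (dyadicGauge W c)) := by
  refine dyadicGauge_le_iff.2 fun n habc => ?_
  have hhalf : (1 / 2 : ℝ≥0) ^ n = 2 * (1 / 2) ^ (n + 1) := by rw [pow_succ']; simp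
  rw [hhalf]
  gcongr
  by_cases ha : a ∈ W (n + 1)
  · by_cases hb : b ∈ W (n + 1)
    · have hc : c ∉ W (n + 1) := fun hc => habc (hW.sup_sup_mem n a ha b hb c hc)
      exact le_max_of_le_right (le_max_of_le_right (pow_le_dyadicGauge hc))
    · exact le_max_of_le_right (le_max_of_le_left (pow_le_dyadicGauge hb))
  · exact le_max_of_le_left (pow_le_dyadicGauge ha)

theorem IsNbhdChain.dyadicGauge_le (hW : IsNbhdChain W) {a : α} {n : ℕ} (ha : a ∈ W n) :
    dyadicGauge W a ≤ (1 / 2) ^ n :=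
  dyadicGauge_le_iff.2 fun _ hm => pow_le_pow_of_le_one zero_le
    (NNReal.half_lt_self one_ne_zero).le (not_lt.1 fun hmn => hm (hW.antitone hmn.le ha))

theorem IsNbhdChain.tendsto_dyadicGauge (hW : IsNbhdChain W) {x : ℕ → α}
    (hx : IsNull atTop x) :
    Tendsto (fun n => dyadicGauge W (x n)) atTop (𝓝 0) := by
  refine tendsto_order.2 ⟨fun r hr => absurd hr not_lt_zero, fun ε hε => ?_⟩
  obtain ⟨m, hm⟩ := exists_pow_lt_of_lt_one hε (NNReal.half_lt_self one_ne_zero)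
  exact ((hW.isNbhd m).absorbsNull x hx).mono fun n hn => (hW.dyadicGauge_le hn).trans_lt hm

end Frame

theorem IsNbhdChain.exists_isMaharamSubmeasure {B : Type u} [CompleteBooleanAlgebra B]
    {W : ℕ → Set B} (hW : IsNbhdChain W) (hbot : ∀ a, (∀ n, a ∈ W n) → a = ⊥) :
    ∃ μ : B → ℝ, IsMaharamSubmeasure μ ∧ IsStrictlyPositive μ := by
  obtain ⟨μ, hμ, hgauge⟩ := exists_isSubmeasure_of_le_two_mul_max hW.monotone_dyadicGauge
    hW.dyadicGauge_bot hW.dyadicGauge_sup_sup_le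
  refine ⟨μ, ⟨hμ, fun a ha hinf => ?_⟩, fun a ha => hbot a fun n => ?_⟩
  · have hlim := hW.tendsto_dyadicGauge (isNull_of_antitone ha hinf)
    exact squeeze_zero (fun n => hμ.nonneg _) (fun n => (hgauge _).1)
      (NNReal.tendsto_coe.2 hlim)
  · by_contra hn
    have hpos : (0 : ℝ) < dyadicGauge W a :=
      NNReal.coe_pos.2 ((by positivity : (0 : ℝ≥0) < (1 / 2) ^ n).trans_le (pow_le_dyadicGauge hn))
    linarith [(hgauge a).2]

end DyadicGauge

end BooleanSubmeasure

theorem mainTheorem3 (hstar : BooleanSubmeasure.PIdealDichotomy.{u})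
    (B : Type u) [CompleteBooleanAlgebra B]
    (hccc : BooleanSubmeasure.CCC B)
    (hwd : BooleanSubmeasure.WeaklyDistributive B) :
    ∃ μ : B → ℝ, BooleanSubmeasure.IsMaharamSubmeasure μ ∧
      BooleanSubmeasure.IsStrictlyPositive μ := by
  obtain ⟨U, hU, hbot⟩ := hstar.exists_isNbhd_seq hccc hwd
  obtain ⟨W, hW, hWbot⟩ := BooleanSubmeasure.exists_isNbhdChain_forall_eq_bot hccc fun a ha => by
    obtain ⟨V, hV, haV⟩ := BooleanSubmeasure.exists_isNbhd_notMem_twoFold hccc hwd hU hbot ha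
    obtain ⟨W, hW, hW0⟩ := hV.exists_isNbhdChain hccc hwd
    exact ⟨W, hW, hW0 ▸ haV⟩
  exact hW.exists_isMaharamSubmeasure hWbot
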